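/- **Theorem 3.2 (Consistency under Strong Assumption).** Let $0<\alpha<1$, let $\theta$ be a random input with law $p$ (the belief distribution), and let $h(\theta;\xi)$ be a measurable real response, where $\xi$ is the simulation noise, whose law may depend on $\theta$. Put $H(\theta)=\mathbb E[h(\theta;\xi)\mid\theta]$ and $\mathcal E(\theta;\xi)=h(\theta;\xi)-H(\theta)$, let $F$ be the c.d.f. of $H(\theta)$, and set $$v_\alpha=\inf\{t:F(t)\ge\alpha\},\qquad c_\alpha=v_\alpha+\frac1{1-\alpha}\,\mathbb E\big[(H(\theta)-v_\alpha)^+\big].$$ Let $\theta_1,\theta_2,\dots$ be i.i.d. with law $p$ and, for each $i$, given $\theta_i$, let $\xi_{i1},\xi_{i2},\dots$ be i.i.d. with the law of $\xi$ given $\theta=\theta_i$, the families $(\theta_i,(\xi_{ij})_{j\ge1})$, $i\ge1$, being independent. For $M,N\ge1$ let $\widehat H_M(\theta_i)=\frac1M\sum_{j=1}^M h(\theta_i;\xi_{ij})$, let $\widetilde v_\alpha^{N,M}$ be the $\lceil\alpha N\rceil$-th smallest of $\widehat H_M(\theta_1),\dots,\widehat H_M(\theta_N)$, and let $$\widetilde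 c_\alpha^{N,M}=\widetilde v_\alpha^{N,M}+\frac1{(1-\alpha)N}\sum_{i=1}^N\big(\widehat H_M(\theta_i)-\widetilde v_\alpha^{N,M}\big)^+ .$$ Assume the Strong Assumption: 1. $\mathbb E[h^2(\theta;\xi)\mid\theta]<\infty$ almost surely and $\mathbb E[h^2(\theta;\xi)]<\infty$. 2. For each $M\ge1$, the pair consisting of $H(\theta)$ and $\bar{\mathcal E}_M=\sqrt M\cdot\frac1M\sum_{j=1}^M\mathcal E(\theta;\xi_j)$, where $\xi_1,\dots,\xi_M$ are i.i.d. copies of $\xi$ given $\theta$, has a joint density $p_M(x,e)$ whose partial derivatives $\partial_x p_M(x,e)$ and $\partial_x^2p_M(x,e)$ exist for all $(x,e)\in\mathbb R^2$. 3. There are nonnegative measurable functions $g_{0,M},g_{1,M},g_{2,M}$ $(M\ge1)$ on $\mathbb R$ with $p_M(x,e)\le g_{0,M}(e)$, $|\partial_xp_M(x,e)|\le g_{1,M}(e)$ and $|\partial_x^2p_M(x,e)|\le g_{2,M}(e)$ for all $(x,e)$, and $\sup_{M\ge1}\int_{\mathbb R}|e|^r g_{i,M}(e)\,de<\infty$ for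 $i=0,1,2$ and all real $0\le r\le4$. Assume moreover that $H(\theta)$ has a density $f$ that is continuous at $v_\alpha$ with $f(v_\alpha)>0$. Then, almost surely, $$\lim_{N,M\to\infty}\widetilde v_\alpha^{N,M}=v_\alpha\qquad\text{and}\qquad\lim_{N,M\to\infty}\widetilde c_\alpha^{N,M}=c_\alpha ,$$ as double limits: almost surely, for every $\varepsilon>0$ there is $K$ such that for all $N,M\ge K$ the estimators are within $\varepsilon$ of their limits. -/

import Mathlib

open MeasureTheory ProbabilityTheory Filter Topology
open scoped ENNReal

noncomputable section

namespace NestedRisk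

/-- `f` is a (nonnegative, measurable) density of the measure `ν` with respect to Lebesgue measure. -/
structure IsDensity {E : Type*} [MeasureSpace E] (ν : Measure E) (f : E → ℝ) : Prop where
  measurable : Measurable f
  nonneg : ∀ x, 0 ≤ f x
  eq_withDensity : ν = (volume : Measure E).withDensity (fun x => ENNReal.ofReal (f x))

/-- Value at risk of a distribution `ν` on the line: the lower `α`-quantile `inf {t | F t ≥ α}`. -/
def valueAtRisk (ν : Measure ℝ) (α : ℝ) : ℝ :=
  sInf {t : ℝ | α ≤ cdf ν t}

/-- Conditional value at risk of a distribution `ν`: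
`v + (1 - α)⁻¹ E[(X - v)⁺]` with `X ∼ ν` and `v` its value at risk. -/
def condValueAtRisk (ν : Measure ℝ) (α : ℝ) : ℝ :=
  valueAtRisk ν α + 1 / (1 - α) * ∫ x, max (x - valueAtRisk ν α) 0 ∂ν

/-- The `k`-th smallest (`1 ≤ k ≤ N`) of the numbers `x 0, …, x (N - 1)`, ties being repeated. -/
def orderStat {N : ℕ} (x : Fin N → ℝ) (k : ℕ) : ℝ :=
  if hk : 1 ≤ k ∧ k ≤ N then x (Tuple.sort x ⟨k - 1, by omega⟩) else 0

section Model

variable {Θ Ξ : Type*} [MeasurableSpace Θ] [MeasurableSpace Ξ]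

/-- Mean response `H(t) = E[h(t; ξ)]`, where `ξ ∼ κ t` is the simulation noise at the input `t`. -/
def meanResponse (κ : Kernel Θ Ξ) (h : Θ → Ξ → ℝ) (t : Θ) : ℝ :=
  ∫ x, h t x ∂(κ t)

/-- Conditional second moment `E[h(t; ξ)² | t]` of the response, with values in `[0, ∞]`. -/
def condSecondMoment (κ : Kernel Θ Ξ) (h : Θ → Ξ → ℝ) (t : Θ) : ℝ≥0∞ :=
  ∫⁻ x, ENNReal.ofReal ((h t x) ^ 2) ∂(κ t)

/-- Stochastic noise `h(t; x) - H(t)`. -/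
def noise (κ : Kernel Θ Ξ) (h : Θ → Ξ → ℝ) (t : Θ) (x : Ξ) : ℝ :=
  h t x - meanResponse κ h t

/-- Law of the mean response `H(θ)` when `θ` follows the belief distribution `μ`. -/
def meanResponseLaw (μ : Measure Θ) (κ : Kernel Θ Ξ) (h : Θ → Ξ → ℝ) : Measure ℝ :=
  μ.map (meanResponse κ h)

variable {Ω : Type*} [MeasurableSpace Ω]

/-- Two-layer sampling scheme. The scenarios `θ 0, θ 1, …` are drawn independently from the belief
distribution `μ`; given `θ i`, the inner samples `ξ i 0, ξ i 1, …` are drawn independently from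
`κ (θ i)`; different scenarios together with their inner samples are independent. -/
structure IsNestedSample (P : Measure Ω) (μ : Measure Θ) (κ : Kernel Θ Ξ)
    (θ : ℕ → Ω → Θ) (ξ : ℕ → ℕ → Ω → Ξ) : Prop where
  measurable_outer : ∀ i, Measurable (θ i)
  measurable_inner : ∀ i j, Measurable (ξ i j)
  indep : iIndepFun (fun (i : ℕ) (ω : Ω) => ((θ i ω, fun j => ξ i j ω) : Θ × (ℕ → Ξ))) P
  law : ∀ (i n : ℕ) (A : Set Θ) (B : Fin n → Set Ξ), MeasurableSet A →
    (∀ j, MeasurableSet (B j)) →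
    P {ω | θ i ω ∈ A ∧ ∀ j : Fin n, ξ i j ω ∈ B j} = ∫⁻ t in A, ∏ j : Fin n, κ t (B j) ∂μ

/-- Sample average of the first `M` responses at the scenario `θ i`. -/
def sampleMean (h : Θ → Ξ → ℝ) (θ : ℕ → Ω → Θ) (ξ : ℕ → ℕ → Ω → Ξ) (M i : ℕ) (ω : Ω) : ℝ :=
  1 / (M : ℝ) * ∑ j ∈ Finset.range M, h (θ i ω) (ξ i j ω)

/-- Normalized noise `√M · (1/M) ∑_{j < M} noise(θ i; ξ i j)`. -/
def normalizedNoise (κ : Kernel Θ Ξ) (h : Θ → Ξ → ℝ) (θ : ℕ → Ω → Θ) (ξ : ℕ → ℕ → Ω → Ξ)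
    (M i : ℕ) (ω : Ω) : ℝ :=
  Real.sqrt M * (1 / (M : ℝ) * ∑ j ∈ Finset.range M, noise κ h (θ i ω) (ξ i j ω))

/-- Joint law of the mean response and the normalized noise of inner sample size `M`
(at the first scenario; all scenarios have the same law). -/
def jointLaw (P : Measure Ω) (κ : Kernel Θ Ξ) (h : Θ → Ξ → ℝ) (θ : ℕ → Ω → Θ)
    (ξ : ℕ → ℕ → Ω → Ξ) (M : ℕ) : Measure (ℝ × ℝ) :=
  P.map (fun ω => (meanResponse κ h (θ 0 ω), normalizedNoise κ h θ ξ M 0 ω))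

/-- Nested estimator of the value at risk: the `⌈αN⌉`-th smallest of the `N` sample means, each of
inner sample size `M` (the `αN`-th smallest when `αN` is an integer). -/
def nestedVaR (α : ℝ) (h : Θ → Ξ → ℝ) (θ : ℕ → Ω → Θ) (ξ : ℕ → ℕ → Ω → Ξ) (N M : ℕ) (ω : Ω) : ℝ :=
  orderStat (fun i : Fin N => sampleMean h θ ξ M i ω) ⌈α * (N : ℝ)⌉₊

/-- Nested estimator of the conditional value at risk. -/
def nestedCVaR (α : ℝ) (h : Θ → Ξ → ℝ) (θ : ℕ → Ω → Θ) (ξ : ℕ → ℕ → Ω → Ξ) (N M : ℕ) (ω : Ω) : ℝ :=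
  nestedVaR α h θ ξ N M ω + 1 / ((1 - α) * (N : ℝ)) *
    ∑ i ∈ Finset.range N, max (sampleMean h θ ξ M i ω - nestedVaR α h θ ξ N M ω) 0

/-- The Strong Assumption: finite second moments; a joint density `p M` of the mean response and the
normalized noise that is twice differentiable in its first argument; and dominating functions
`g i M` of the second argument, for `p M` and its first two derivatives, whose absolute moments of
every order `r ∈ [0, 4]` are bounded over all inner sample sizes `M ≥ 1`. -/
structure StrongAssumption (P : Measure Ω) (μ : Measure Θ) (κ : Kernel Θ Ξ) (h : Θ → Ξ → ℝ)
    (θ : ℕ → Ω → Θ) (ξ : ℕ → ℕ → Ω → Ξ) : Prop where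
  condSecondMoment_lt_top : ∀ᵐ t ∂μ, condSecondMoment κ h t < ⊤
  secondMoment_lt_top : ∫⁻ t, condSecondMoment κ h t ∂μ < ⊤
  exists_density : ∃ (p : ℕ → ℝ → ℝ → ℝ) (g : Fin 3 → ℕ → ℝ → ℝ),
    (∀ M, 1 ≤ M → IsDensity (jointLaw P κ h θ ξ M) (fun z : ℝ × ℝ => p M z.1 z.2)) ∧
    (∀ M, 1 ≤ M → ∀ x e, DifferentiableAt ℝ (fun y => p M y e) x ∧
      DifferentiableAt ℝ (deriv fun y => p M y e) x) ∧
    (∀ i M, 1 ≤ M → Measurable (g i M) ∧ ∀ e, 0 ≤ g i M e) ∧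
    (∀ M, 1 ≤ M → ∀ x e, p M x e ≤ g 0 M e ∧
      |deriv (fun y => p M y e) x| ≤ g 1 M e ∧
      |deriv (deriv fun y => p M y e) x| ≤ g 2 M e) ∧
    (∀ (i : Fin 3) (r : ℝ), 0 ≤ r → r ≤ 4 →
      (⨆ (M : ℕ) (_ : 1 ≤ M), ∫⁻ e : ℝ, ENNReal.ofReal (|e| ^ r * g i M e)) < ⊤)

end Model

end NestedRisk

end

/-!
The estimators depend on the array of sample means `Ĥ_M(θ i)` only through its empirical
distribution over `i < N`, and both are stable under perturbations of that array which are small in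
averaged absolute value. The heart of the matter is therefore that, almost surely,
`(1/N) ∑_{i < N} |Ĥ_M(θ i) - H(θ i)|` tends to `0` as `N` and `M` tend to infinity jointly.

For a fixed `K`, all errors with `M ≥ K` are dominated by the tail supremum
`R_K(θ i, ξ i ·) = sup_{M ≥ K} |Ĥ_M(θ i) - H(θ i)|` (`tailDeviation`), and over `i` these are
i.i.d. The strong law gives `(1/N) ∑_{i < N} R_K → E[R_K]` almost surely, uniformly over all
`M ≥ K` since `M` no longer appears. It remains to see that `E[R_K] → 0`. Given the scenario, the
strong law for the inner samples yields `R_K → 0` almost surely, so by dominated convergence it is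
enough that `E[R_0] < ∞`. This is the maximal inequality `lintegral_iSup_runningMean_le`: every
running mean of nonnegative numbers is at most twice a dyadic one, and the variances of the running
means at the times `2 ^ k` form a convergent geometric series.

Markov's inequality for the empirical measure then transfers the law of large numbers for the
indicators of `{H(θ i) ≤ q}`, `q` rational, to the perturbed array. The distribution function of
`H(θ)` is below `α` to the left of the quantile, and above `α` to its right because the density is
positive near it; so the order statistics converge (`tendsto_orderStat`). As `(x, c) ↦ (x - c)⁺` is
Lipschitz, the averaged excesses converge as well (`tendsto_runningMean_excess`).
-/

namespace NestedRisk

/-! ### Running means and empirical quantiles -/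

/-- The average of the first `n` terms of a real sequence (`0` for `n = 0`). -/
noncomputable def runningMean (y : ℕ → ℝ) (n : ℕ) : ℝ :=
  1 / (n : ℝ) * ∑ j ∈ Finset.range n, y j

lemma runningMean_eq_div (y : ℕ → ℝ) :
    runningMean y = fun n => (∑ j ∈ Finset.range n, y j) / n := by
  ext n
  rw [runningMean, one_div, inv_mul_eq_div]

lemma runningMean_mono {y z : ℕ → ℝ} (hyz : ∀ j, y j ≤ z j) (n : ℕ) :
    runningMean y n ≤ runningMean z n :=
  mul_le_mul_of_nonneg_left (Finset.sum_le_sum fun j _ => hyz j) (by positivity)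

lemma runningMean_nonneg {y : ℕ → ℝ} (hy : ∀ j, 0 ≤ y j) (n : ℕ) : 0 ≤ runningMean y n :=
  mul_nonneg (by positivity) (Finset.sum_nonneg fun j _ => hy j)

lemma runningMean_add (y z : ℕ → ℝ) (n : ℕ) :
    runningMean (fun j => y j + z j) n = runningMean y n + runningMean z n := by
  simp only [runningMean, Finset.sum_add_distrib, mul_add]

lemma runningMean_const_mul (c : ℝ) (y : ℕ → ℝ) (n : ℕ) :
    runningMean (fun j => c * y j) n = c * runningMean y n := by
  simp only [runningMean, ← Finset.mul_sum]
  ring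

lemma runningMean_const (c : ℝ) {n : ℕ} (hn : 0 < n) : runningMean (fun _ => c) n = c := by
  have : (n : ℝ) ≠ 0 := by positivity
  simp [runningMean]
  field_simp

lemma abs_runningMean_le (y : ℕ → ℝ) (n : ℕ) :
    |runningMean y n| ≤ runningMean (fun j => |y j|) n := by
  rw [runningMean, abs_mul, abs_of_nonneg (by positivity : (0 : ℝ) ≤ 1 / (n : ℝ))]
  exact mul_le_mul_of_nonneg_left (Finset.abs_sum_le_sum_abs _ _) (by positivity)

/-- The `⌈αN⌉`-th order statistic is the empirical `α`-quantile: it is at most `w` exactly when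
the empirical distribution function at `w` is at least `α`. -/
lemma orderStat_le_iff {α : ℝ} (hα0 : 0 < α) (hα1 : α ≤ 1) (b : ℕ → ℝ) {N : ℕ} (hN : 0 < N)
    (w : ℝ) :
    orderStat (fun i : Fin N => b i) ⌈α * (N : ℝ)⌉₊ ≤ w ↔
      α ≤ runningMean (fun i => (Set.Iic w).indicator 1 (b i)) N := by
  have hN' : (0 : ℝ) < N := by exact_mod_cast hN
  have hk1 : 1 ≤ ⌈α * (N : ℝ)⌉₊ := Nat.one_le_iff_ne_zero.2 (Nat.ceil_pos.2 (by positivity)).ne'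
  have hk2 : ⌈α * (N : ℝ)⌉₊ ≤ N := Nat.ceil_le.2 (by nlinarith)
  have hcard : (Finset.univ.filter fun i : Fin N =>
      ((fun i : Fin N => b i) ∘ Tuple.sort (fun i : Fin N => b i)) i ≤ w).card
      = (Finset.univ.filter fun i : Fin N => b i ≤ w).card :=
    Finset.card_equiv (Tuple.sort (fun i : Fin N => b i)) (by simp)
  have hsum : ∑ j ∈ Finset.range N, (Set.Iic w).indicator (1 : ℝ → ℝ) (b j)
      = ((Finset.univ.filter fun i : Fin N => b i ≤ w).card : ℝ) := by
    rw [Finset.sum_range fun j => (Set.Iic w).indicator (1 : ℝ → ℝ) (b j)]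
    simp [Set.indicator_apply]
  have key := Tuple.lt_card_le_iff_apply_le_of_monotone
    (f := (fun i : Fin N => b i) ∘ Tuple.sort (fun i : Fin N => b i)) (a := w)
    (j := (⟨⌈α * (N : ℝ)⌉₊ - 1, by omega⟩ : Fin N)) (Tuple.monotone_sort _)
  rw [hcard] at key
  rw [orderStat, dif_pos ⟨hk1, hk2⟩]
  refine key.symm.trans ?_
  rw [runningMean, hsum, one_div, inv_mul_eq_div, le_div_iff₀ hN', ← Nat.ceil_le]
  simp only
  omega

/-- If a double array `b` approximates a sequence `a` in averaged absolute deviation, and the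
empirical distribution functions of `a` converge at rational points to a function that crosses the
level `α` exactly at `v`, then the `⌈αN⌉`-th order statistics of the array converge to `v`. -/
lemma tendsto_orderStat {α v : ℝ} (hα0 : 0 < α) (hα1 : α ≤ 1) {F : ℝ → ℝ}
    (hlt : ∀ t < v, F t < α) (hgt : ∀ t, v < t → α < F t) {a : ℕ → ℝ} {b : ℕ → ℕ → ℝ}
    (hF : ∀ q : ℚ, Tendsto (runningMean fun i => (Set.Iic (q : ℝ)).indicator 1 (a i)) atTop
      (𝓝 (F q)))
    (hdev : Tendsto (fun q : ℕ × ℕ => runningMean (fun i => |b q.2 i - a i|) q.1)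
      (atTop ×ˢ atTop) (𝓝 0)) :
    Tendsto (fun q : ℕ × ℕ => orderStat (fun i : Fin q.1 => b q.2 i) ⌈α * (q.1 : ℝ)⌉₊)
      (atTop ×ˢ atTop) (𝓝 v) := by
  have hpos : ∀ᶠ q : ℕ × ℕ in atTop ×ˢ atTop, 0 < q.1 :=
    tendsto_fst.eventually (eventually_gt_atTop 0)
  -- Markov's inequality for the counting measure: moving `a` to `b` and `s` to `w` changes an
  -- indicator only where the deviation is at least `w - s`.
  have hmarkov : ∀ {s w x y : ℝ}, s < w → (Set.Iic s).indicator (1 : ℝ → ℝ) x ≤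
      (Set.Iic w).indicator (1 : ℝ → ℝ) y + (w - s)⁻¹ * |y - x| := by
    intro s w x y hsw
    have h0 : 0 < w - s := sub_pos.2 hsw
    have h1 : 0 ≤ (w - s)⁻¹ * |y - x| := by positivity
    simp only [Set.indicator_apply, Set.mem_Iic, Pi.one_apply]
    split_ifs with hx hy hy
    · linarith
    · have : w - s ≤ |y - x| := le_trans (by linarith) (le_abs_self _)
      rw [inv_mul_eq_div, zero_add, le_div_iff₀ h0]
      linarith
    · linarith
    · linarith
  refine tendsto_order.2 ⟨fun w hw => ?_, fun u hu => ?_⟩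
  · obtain ⟨q, hwq, hqv⟩ := exists_rat_btwn hw
    have hlim : Tendsto (fun p : ℕ × ℕ =>
        runningMean (fun i => (Set.Iic (q : ℝ)).indicator 1 (a i)) p.1
        + ((q : ℝ) - w)⁻¹ * runningMean (fun i => |b p.2 i - a i|) p.1) (atTop ×ˢ atTop)
        (𝓝 (F q + ((q : ℝ) - w)⁻¹ * 0)) :=
      ((hF q).comp tendsto_fst).add (hdev.const_mul _)
    rw [mul_zero, add_zero] at hlim
    filter_upwards [hpos, hlim.eventually_lt_const (hlt q hqv)] with p hp hp2
    rw [← not_le, orderStat_le_iff hα0 hα1 _ hp, not_le]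
    refine lt_of_le_of_lt ?_ hp2
    rw [← runningMean_const_mul, ← runningMean_add]
    refine runningMean_mono (fun i => ?_) _
    rw [abs_sub_comm]
    exact hmarkov hwq
  · obtain ⟨q, hvq, hqu⟩ := exists_rat_btwn hu
    obtain ⟨w, hqw, hwu⟩ := exists_between hqu
    have hlim : Tendsto (fun p : ℕ × ℕ =>
        runningMean (fun i => (Set.Iic (q : ℝ)).indicator 1 (a i)) p.1
        - (w - (q : ℝ))⁻¹ * runningMean (fun i => |b p.2 i - a i|) p.1) (atTop ×ˢ atTop)
        (𝓝 (F q - (w - (q : ℝ))⁻¹ * 0)) :=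
      ((hF q).comp tendsto_fst).sub (hdev.const_mul _)
    rw [mul_zero, sub_zero] at hlim
    filter_upwards [hpos, hlim.eventually_const_lt (hgt q hvq)] with p hp hp2
    refine lt_of_le_of_lt ?_ hwu
    rw [orderStat_le_iff hα0 hα1 _ hp]
    refine hp2.le.trans ?_
    rw [sub_le_iff_le_add, ← runningMean_const_mul, ← runningMean_add]
    exact runningMean_mono (fun i => hmarkov hqw) _

/-- Averaged excesses over a converging threshold converge, since `(x, c) ↦ (x - c)⁺` is
`1`-Lipschitz in each variable. -/
lemma tendsto_runningMean_excess {v e : ℝ} {a : ℕ → ℝ} {b : ℕ → ℕ → ℝ} {c : ℕ × ℕ → ℝ}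
    (hc : Tendsto c (atTop ×ˢ atTop) (𝓝 v))
    (he : Tendsto (runningMean fun i => max (a i - v) 0) atTop (𝓝 e))
    (hdev : Tendsto (fun q : ℕ × ℕ => runningMean (fun i => |b q.2 i - a i|) q.1)
      (atTop ×ˢ atTop) (𝓝 0)) :
    Tendsto (fun q : ℕ × ℕ => runningMean (fun i => max (b q.2 i - c q) 0) q.1)
      (atTop ×ˢ atTop) (𝓝 e) := by
  have hc' : Tendsto (fun q => |c q - v|) (atTop ×ˢ atTop) (𝓝 0) := by
    simpa using (hc.sub_const v).abs
  have hbd : Tendsto (fun q : ℕ × ℕ =>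
      runningMean (fun i => max (b q.2 i - c q) 0) q.1 - runningMean (fun i => max (a i - v) 0) q.1)
      (atTop ×ˢ atTop) (𝓝 0) := by
    have hsum := hdev.add hc'
    rw [add_zero] at hsum
    refine squeeze_zero_norm' ?_ hsum
    filter_upwards [tendsto_fst.eventually (eventually_gt_atTop 0)] with q hq
    have hsub : runningMean (fun i => max (b q.2 i - c q) 0) q.1
        - runningMean (fun i => max (a i - v) 0) q.1
        = runningMean (fun i => max (b q.2 i - c q) 0 - max (a i - v) 0) q.1 := by
      simp only [runningMean, Finset.sum_sub_distrib, mul_sub]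
    rw [Real.norm_eq_abs, hsub, ← runningMean_const |c q - v| hq, ← runningMean_add]
    refine (abs_runningMean_le _ _).trans (runningMean_mono (fun i => ?_) _)
    refine (abs_max_sub_max_le_abs _ _ _).trans ?_
    calc |b q.2 i - c q - (a i - v)| = |(b q.2 i - a i) - (c q - v)| := by ring_nf
      _ ≤ _ := abs_sub _ _
  simpa using hbd.add (he.comp tendsto_fst)

/-- A deviation that is dominated, from inner size `K` on, by a sequence with limiting average
`ρ K` is averaged out in the double limit as soon as `ρ K → 0`. -/
lemma tendsto_runningMean_deviation {d r : ℕ → ℕ → ℝ} {ρ : ℕ → ℝ}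
    (hd : ∀ M i, 0 ≤ d M i) (hdr : ∀ K M i, K ≤ M → d M i ≤ r K i)
    (hr : ∀ K, Tendsto (runningMean (r K)) atTop (𝓝 (ρ K))) (hρ : Tendsto ρ atTop (𝓝 0)) :
    Tendsto (fun q : ℕ × ℕ => runningMean (d q.2) q.1) (atTop ×ˢ atTop) (𝓝 0) := by
  refine tendsto_order.2 ⟨fun w hw => ?_, fun u hu => ?_⟩
  · exact Eventually.of_forall fun q => hw.trans_le (runningMean_nonneg (hd _) _)
  · obtain ⟨K, hK⟩ := (hρ.eventually_lt_const hu).exists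
    filter_upwards [((hr K).eventually_lt_const hK).prod_mk (eventually_ge_atTop K)] with q hq
    exact (runningMean_mono (fun i => hdr K q.2 i hq.2) _).trans_lt hq.1

/-! ### Quantiles of distributions with a positive density -/

lemma cdf_lt_of_lt_valueAtRisk {ν : Measure ℝ} [IsProbabilityMeasure ν] {α : ℝ} (hα0 : 0 < α)
    {t : ℝ} (ht : t < valueAtRisk ν α) : cdf ν t < α := by
  by_contra! hcon
  obtain ⟨s, hs⟩ := ((tendsto_cdf_atBot ν).eventually_lt_const hα0).exists
  refine absurd ht (not_lt.2 (csInf_le ⟨s, fun u hu => ?_⟩ hcon))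
  by_contra! hus
  exact absurd (hu.trans ((monotone_cdf ν) hus.le)) (not_le.2 hs)

lemma le_cdf_of_valueAtRisk_lt {ν : Measure ℝ} [IsProbabilityMeasure ν] {α : ℝ} (hα1 : α < 1)
    {t : ℝ} (ht : valueAtRisk ν α < t) : α ≤ cdf ν t := by
  obtain ⟨s, hs⟩ := ((tendsto_cdf_atTop ν).eventually_const_lt hα1).exists
  obtain ⟨u, hu, hut⟩ := exists_lt_of_csInf_lt (s := {t : ℝ | α ≤ cdf ν t}) ⟨s, hs.le⟩ ht
  exact hu.trans ((monotone_cdf ν) hut.le)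

/-- A density that is continuous and positive at the quantile makes the distribution function
exceed the level strictly to the right of the quantile. -/
lemma lt_cdf_of_valueAtRisk_lt {ν : Measure ℝ} [IsProbabilityMeasure ν] {α : ℝ} (hα1 : α < 1)
    {f : ℝ → ℝ} (hf : IsDensity ν f) (hfcont : ContinuousAt f (valueAtRisk ν α))
    (hfpos : 0 < f (valueAtRisk ν α)) {t : ℝ} (ht : valueAtRisk ν α < t) : α < cdf ν t := by
  set v := valueAtRisk ν α with hv
  obtain ⟨δ, hδ, hball⟩ := Metric.eventually_nhds_iff.1 (hfcont.eventually_const_lt hfpos)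
  obtain ⟨w, hvw, hw⟩ := exists_between (lt_min (lt_add_of_pos_right v hδ) ht)
  obtain ⟨s, hvs, hsw⟩ := exists_between hvw
  have hpos : 0 < ν (Set.Ioc s w) := by
    rw [hf.eq_withDensity, withDensity_apply _ measurableSet_Ioc,
      setLIntegral_pos_iff hf.measurable.ennreal_ofReal]
    have hsub : Set.Ioc s w ⊆ Function.support (fun x => ENNReal.ofReal (f x)) ∩ Set.Ioc s w := by
      intro x hx
      refine ⟨?_, hx⟩
      have : dist x v < δ := by
        rw [Real.dist_eq, abs_of_pos (by linarith [hx.1])]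
        linarith [hx.2, min_le_left (v + δ) t]
      simpa using hball this
    refine lt_of_lt_of_le ?_ (measure_mono hsub)
    simpa using hsw
  have hlt : cdf ν s < cdf ν w := by
    rw [cdf_eq_real, cdf_eq_real, ← sub_pos,
      ← measureReal_sdiff (Set.Iic_subset_Iic.2 hsw.le) measurableSet_Iic, Set.Iic_sdiff_Iic]
    exact ENNReal.toReal_pos hpos.ne' (measure_ne_top _ _)
  exact (le_cdf_of_valueAtRisk_lt hα1 hvs).trans_lt
    (hlt.trans_le ((monotone_cdf ν) (hw.le.trans (min_le_right _ _))))

/-! ### A maximal inequality for running means -/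

lemma exists_runningMean_le_dyadic {y : ℕ → ℝ} (hy : ∀ j, 0 ≤ y j) (M : ℕ) :
    ∃ k : ℕ, runningMean y M ≤ 2 * runningMean y (2 ^ k) := by
  rcases Nat.eq_zero_or_pos M with rfl | hM
  · exact ⟨0, by simpa [runningMean] using hy 0⟩
  refine ⟨Nat.log 2 M + 1, ?_⟩
  have h1 : 2 ^ (Nat.log 2 M + 1) ≤ 2 * M := by
    rw [pow_succ, mul_comm]
    exact Nat.mul_le_mul_left _ (Nat.pow_log_le_self 2 hM.ne')
  have h2 : M ≤ 2 ^ (Nat.log 2 M + 1) := (Nat.lt_pow_succ_log_self one_lt_two M).le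
  generalize 2 ^ (Nat.log 2 M + 1) = n at h1 h2
  have hM' : (0 : ℝ) < M := by exact_mod_cast hM
  have hn' : (0 : ℝ) < n := by exact_mod_cast hM.trans_le h2
  have h1' : (n : ℝ) ≤ 2 * M := by exact_mod_cast h1
  rw [runningMean, runningMean, ← mul_assoc]
  refine mul_le_mul ?_ (Finset.sum_le_sum_of_subset_of_nonneg (Finset.range_mono h2)
    fun j _ _ => hy j) (Finset.sum_nonneg fun j _ => hy j) (by positivity)
  rw [mul_one_div, div_le_div_iff₀ hM' hn']
  linarith

/-- Every average of a nonnegative sequence is controlled by the squared deviations of the dyadic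
averages from an arbitrary centre `m`. -/
lemma iSup_ofReal_runningMean_le {y : ℕ → ℝ} (hy : ∀ j, 0 ≤ y j) {m : ℝ} (hm : 0 ≤ m) :
    ⨆ M, ENNReal.ofReal (runningMean y M) ≤
      2 * (ENNReal.ofReal m + 1 + ∑' k, ENNReal.ofReal ((runningMean y (2 ^ k) - m) ^ 2)) := by
  refine iSup_le fun M => ?_
  obtain ⟨k, hk⟩ := exists_runningMean_le_dyadic hy M
  calc ENNReal.ofReal (runningMean y M)
      ≤ ENNReal.ofReal (2 * (m + 1 + (runningMean y (2 ^ k) - m) ^ 2)) := by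
        refine ENNReal.ofReal_le_ofReal (hk.trans ?_)
        nlinarith [sq_nonneg (runningMean y (2 ^ k) - m - 1)]
    _ = 2 * (ENNReal.ofReal m + 1 + ENNReal.ofReal ((runningMean y (2 ^ k) - m) ^ 2)) := by
        rw [ENNReal.ofReal_mul zero_le_two, ENNReal.ofReal_add (by positivity) (by positivity),
          ENNReal.ofReal_add hm zero_le_one]
        simp
    _ ≤ _ := by
        gcongr
        exact ENNReal.le_tsum (f := fun k => ENNReal.ofReal ((runningMean y (2 ^ k) - m) ^ 2)) k

section Probability

variable {Ω : Type*} [MeasurableSpace Ω] {P : Measure Ω} [IsProbabilityMeasure P]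

lemma lintegral_sq_runningMean_sub {Y : ℕ → Ω → ℝ} (hL2 : MemLp (Y 0) 2 P)
    (hindep : Pairwise fun i j => Y i ⟂ᵢ[P] Y j) (hident : ∀ i, IdentDistrib (Y i) (Y 0) P P)
    {n : ℕ} (hn : 0 < n) :
    ∫⁻ ω, ENNReal.ofReal ((runningMean (fun j => Y j ω) n - P[Y 0]) ^ 2) ∂P
      = ENNReal.ofReal (variance (Y 0) P / n) := by
  have hn' : (n : ℝ) ≠ 0 := by positivity
  have hL2' : ∀ i, MemLp (Y i) 2 P := fun i => (hident i).symm.memLp_iff.1 hL2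
  have hfun : (fun ω => runningMean (fun j => Y j ω) n)
      = fun ω => 1 / (n : ℝ) * (∑ j ∈ Finset.range n, Y j) ω := by
    ext ω
    simp [runningMean]
  have hLs : MemLp (∑ j ∈ Finset.range n, Y j) 2 P := memLp_finsetSum' _ fun i _ => hL2' i
  have hLm : MemLp (fun ω => runningMean (fun j => Y j ω) n) 2 P := by
    rw [hfun]
    exact hLs.const_mul _
  have hmean : P[fun ω => runningMean (fun j => Y j ω) n] = P[Y 0] := by
    simp only [runningMean]
    rw [integral_const_mul, integral_finsetSum _
      fun i _ => (hL2' i).integrable one_le_two]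
    simp only [(hident _).integral_eq, Finset.sum_const, Finset.card_range, nsmul_eq_mul]
    field_simp
  have hvar : variance (fun ω => runningMean (fun j => Y j ω) n) P = variance (Y 0) P / n := by
    rw [hfun, variance_const_mul, IndepFun.variance_sum (fun i _ => hL2' i)
      (fun i _ j _ hij => hindep hij)]
    simp only [(hident _).variance_eq, Finset.sum_const, Finset.card_range, nsmul_eq_mul]
    field_simp
  rw [← hvar, variance_eq_integral hLm.aemeasurable, hmean, ofReal_integral_eq_lintegral_ofReal]
  · exact (hLm.sub (memLp_const _)).integrable_sq
  · exact Eventually.of_forall fun ω => sq_nonneg _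

lemma lintegral_enorm_le_one_add_sq (Y : Ω → ℝ) :
    ∫⁻ ω, ‖Y ω‖ₑ ∂P ≤ 1 + ∫⁻ ω, ENNReal.ofReal (Y ω ^ 2) ∂P := by
  calc ∫⁻ ω, ‖Y ω‖ₑ ∂P ≤ ∫⁻ ω, (1 + ENNReal.ofReal (Y ω ^ 2)) ∂P := by
        refine lintegral_mono fun ω => ?_
        rw [← ENNReal.ofReal_one, ← ENNReal.ofReal_add zero_le_one (sq_nonneg _),
          Real.enorm_eq_ofReal_abs]
        refine ENNReal.ofReal_le_ofReal ?_
        nlinarith [sq_abs (Y ω), sq_nonneg (|Y ω| - 1), abs_nonneg (Y ω)]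
    _ = 1 + ∫⁻ ω, ENNReal.ofReal (Y ω ^ 2) ∂P := by
        rw [lintegral_add_left measurable_const]
        simp

/-- Maximal inequality: the supremum of the running means of square-integrable nonnegative i.i.d.
variables is integrable, with a bound in terms of the second moment only. Nonnegativity reduces
the supremum to dyadic times, where the variances are summable. -/
lemma lintegral_iSup_runningMean_le {Y : ℕ → Ω → ℝ} (hmeas : ∀ j, Measurable (Y j))
    (hY : ∀ j ω, 0 ≤ Y j ω) (hL2 : MemLp (Y 0) 2 P)
    (hindep : Pairwise fun i j => Y i ⟂ᵢ[P] Y j) (hident : ∀ i, IdentDistrib (Y i) (Y 0) P P) :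
    ∫⁻ ω, ⨆ M, ENNReal.ofReal (runningMean (fun j => Y j ω) M) ∂P
      ≤ 4 + 6 * ∫⁻ ω, ENNReal.ofReal (Y 0 ω ^ 2) ∂P := by
  have hm : 0 ≤ P[Y 0] := integral_nonneg (hY 0)
  have hrm : ∀ n, Measurable fun ω => runningMean (fun j => Y j ω) n := fun n =>
    (Finset.measurable_fun_sum _ fun j _ => hmeas j).const_mul _
  have hmean : ENNReal.ofReal (P[Y 0]) ≤ 1 + ∫⁻ ω, ENNReal.ofReal (Y 0 ω ^ 2) ∂P := by
    rw [← Real.enorm_of_nonneg hm]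
    exact (enorm_integral_le_lintegral_enorm _).trans (lintegral_enorm_le_one_add_sq _)
  have hvar : ENNReal.ofReal (variance (Y 0) P) ≤ ∫⁻ ω, ENNReal.ofReal (Y 0 ω ^ 2) ∂P := by
    rw [← ofReal_integral_eq_lintegral_ofReal hL2.integrable_sq
      (Eventually.of_forall fun ω => sq_nonneg _)]
    exact ENNReal.ofReal_le_ofReal (variance_le_expectation_sq hL2.aestronglyMeasurable)
  have hsum : ∑' k : ℕ, ∫⁻ ω, ENNReal.ofReal
      ((runningMean (fun j => Y j ω) (2 ^ k) - P[Y 0]) ^ 2) ∂P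
      = 2 * ENNReal.ofReal (variance (Y 0) P) := by
    have hterm : ∀ k : ℕ, ∫⁻ ω, ENNReal.ofReal
        ((runningMean (fun j => Y j ω) (2 ^ k) - P[Y 0]) ^ 2) ∂P
        = ENNReal.ofReal (variance (Y 0) P * (1 / 2) ^ k) := fun k => by
      rw [lintegral_sq_runningMean_sub hL2 hindep hident (by positivity)]
      congr 1
      push_cast
      rw [one_div_pow, mul_one_div]
    simp_rw [hterm]
    rw [← ENNReal.ofReal_tsum_of_nonneg
      (fun k => mul_nonneg (variance_nonneg _ _) (by positivity))
      (summable_geometric_two.mul_left _), tsum_mul_left, tsum_geometric_two, mul_comm,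
      ENNReal.ofReal_mul zero_le_two]
    simp
  calc ∫⁻ ω, ⨆ M, ENNReal.ofReal (runningMean (fun j => Y j ω) M) ∂P
      ≤ ∫⁻ ω, 2 * (ENNReal.ofReal (P[Y 0]) + 1 + ∑' k, ENNReal.ofReal
          ((runningMean (fun j => Y j ω) (2 ^ k) - P[Y 0]) ^ 2)) ∂P :=
        lintegral_mono fun ω => iSup_ofReal_runningMean_le (fun j => hY j ω) hm
    _ = 2 * (ENNReal.ofReal (P[Y 0]) + 1 + 2 * ENNReal.ofReal (variance (Y 0) P)) := by
        rw [lintegral_const_mul' _ _ (by simp), lintegral_add_left measurable_const,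
          lintegral_const, measure_univ, mul_one, lintegral_tsum, hsum]
        exact fun k => (((hrm _).sub_const _).pow_const 2).ennreal_ofReal.aemeasurable
    _ ≤ 2 * ((1 + ∫⁻ ω, ENNReal.ofReal (Y 0 ω ^ 2) ∂P) + 1
          + 2 * ∫⁻ ω, ENNReal.ofReal (Y 0 ω ^ 2) ∂P) := by gcongr
    _ = 4 + 6 * ∫⁻ ω, ENNReal.ofReal (Y 0 ω ^ 2) ∂P := by ring

end Probability

/-! ### The law of a scenario with its inner samples -/

section NestedSampling

variable {Θ Ξ Ω : Type*} [MeasurableSpace Θ] [MeasurableSpace Ξ] [MeasurableSpace Ω]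

/-- The kernel sending an input `t` to the law of an i.i.d. sequence of noises drawn from `κ t`. -/
noncomputable def seqKernel (κ : Kernel Θ Ξ) [IsMarkovKernel κ] : Kernel Θ (ℕ → Ξ) where
  toFun t := Measure.infinitePi fun _ : ℕ => κ t
  measurable' := by
    refine Measurable.measure_of_isPiSystem_of_isProbabilityMeasure
      (generateFrom_squareCylinders (α := fun _ : ℕ => Ξ)).symm
      (isPiSystem_squareCylinders (fun _ => MeasurableSpace.isPiSystem_measurableSet) (by simp)) ?_
    rintro _ ⟨s, B, hB, rfl⟩
    have hB' : ∀ i, MeasurableSet (B i) := fun i => hB i (Set.mem_univ i)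
    simp only [Measure.infinitePi_pi _ fun i _ => hB' i]
    exact Finset.measurable_fun_prod _ fun i _ => κ.measurable_coe (hB' i)

lemma seqKernel_apply (κ : Kernel Θ Ξ) [IsMarkovKernel κ] (t : Θ) :
    seqKernel κ t = Measure.infinitePi fun _ : ℕ => κ t := rfl

instance (κ : Kernel Θ Ξ) [IsMarkovKernel κ] : IsMarkovKernel (seqKernel κ) :=
  ⟨fun t => by rw [seqKernel_apply]; infer_instance⟩

lemma IsNestedSample.measurable_pair {P : Measure Ω} {μ : Measure Θ} {κ : Kernel Θ Ξ}
    {θ : ℕ → Ω → Θ} {ξ : ℕ → ℕ → Ω → Ξ} (hs : IsNestedSample P μ κ θ ξ) (i : ℕ) :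
    Measurable fun ω => (θ i ω, fun j => ξ i j ω) :=
  (hs.measurable_outer i).prodMk (measurable_pi_lambda _ fun j => hs.measurable_inner i j)

/-- A scenario together with its whole sequence of inner samples has law `μ ⊗ₘ seqKernel κ`: the
finite-dimensional laws determine the joint law. -/
lemma IsNestedSample.map_pair {P : Measure Ω} [IsProbabilityMeasure P] {μ : Measure Θ}
    [IsProbabilityMeasure μ] {κ : Kernel Θ Ξ} [IsMarkovKernel κ]
    {θ : ℕ → Ω → Θ} {ξ : ℕ → ℕ → Ω → Ξ} (hs : IsNestedSample P μ κ θ ξ) (i : ℕ) :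
    P.map (fun ω => (θ i ω, fun j => ξ i j ω)) = μ ⊗ₘ seqKernel κ := by
  have hξ : Measurable fun ω => fun j => ξ i j ω :=
    measurable_pi_lambda _ fun j => hs.measurable_inner i j
  have : IsProbabilityMeasure (P.map fun ω => (θ i ω, fun j => ξ i j ω)) :=
    Measure.isProbabilityMeasure_map (hs.measurable_pair i).aemeasurable
  refine Measure.ext_prod fun {A} {T} hA hT => ?_
  rw [Measure.compProd_apply_prod hA hT, Measure.map_apply (hs.measurable_pair i) (hA.prod hT)]
  -- both sides are finite measures in `T`, compared on cylinders
  suffices hext : (P.restrict (θ i ⁻¹' A)).map (fun ω => fun j => ξ i j ω)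
      = (μ.restrict A).bind (seqKernel κ) by
    have h1 := congrArg (fun ν => ν T) hext
    rw [Measure.map_apply hξ hT, Measure.restrict_apply (hξ hT),
      Measure.bind_apply hT (seqKernel κ).measurable.aemeasurable] at h1
    rw [← h1]
    congr 1
    ext ω
    simp [and_comm]
  have hbox : ∀ (n : ℕ) (B : ℕ → Set Ξ), (∀ j, MeasurableSet (B j)) →
      (P.restrict (θ i ⁻¹' A)).map (fun ω => fun j => ξ i j ω)
        (Set.pi (Finset.range n : Set ℕ) B)
      = (μ.restrict A).bind (seqKernel κ) (Set.pi (Finset.range n : Set ℕ) B) := by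
    intro n B hB
    have hT : MeasurableSet (Set.pi (Finset.range n : Set ℕ) B) :=
      MeasurableSet.pi (Finset.countable_toSet _) fun j _ => hB j
    rw [Measure.map_apply hξ hT, Measure.restrict_apply (hξ hT),
      Measure.bind_apply hT (seqKernel κ).measurable.aemeasurable]
    simp only [seqKernel_apply, Measure.infinitePi_pi _ fun j _ => hB j]
    have := hs.law i n A (fun j => B j) hA fun j => hB j
    simp only [Finset.prod_range]
    rw [← this]
    congr 1
    ext ω
    simp only [Set.mem_inter_iff, Set.mem_preimage, Set.mem_pi, Finset.coe_range, Set.mem_Iio,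
      Set.mem_ofPred_eq, and_comm, Fin.forall_iff]
  refine ext_of_generate_finite _
    (generateFrom_squareCylinders (α := fun _ : ℕ => Ξ)).symm
    (isPiSystem_squareCylinders (fun _ => MeasurableSpace.isPiSystem_measurableSet) (by simp))
    ?_ (by simpa using hbox 0 (fun _ => Set.univ) fun _ => MeasurableSet.univ)
  rintro _ ⟨s, B, hB, rfl⟩
  classical
  have hB' : ∀ j, MeasurableSet (B j) := fun j => hB j (Set.mem_univ j)
  have hrew : (s : Set ℕ).pi B = Set.pi (Finset.range (s.sup id + 1) : Set ℕ)
      fun j => if j ∈ s then B j else Set.univ := by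
    ext x
    simp only [Set.mem_pi, Finset.mem_coe, Finset.mem_range]
    refine ⟨fun hx j _ => ?_, fun hx j hj => ?_⟩
    · split_ifs with hj
      · exact hx j hj
      · trivial
    · simpa [hj] using hx j (Nat.lt_succ_of_le (Finset.le_sup (f := id) hj))
  rw [hrew]
  refine hbox _ _ fun j => ?_
  split_ifs
  · exact hB' j
  · exact MeasurableSet.univ

/-! ### Tail suprema of the errors of the inner sample means -/

/-- The largest deviation, over all inner sample sizes `M ≥ K`, of the sample mean of the responses
from the mean response, as a function of a scenario and its infinite sequence of inner samples.
It takes values in `[0, ∞]`, so that the supremum is measurable and needs no boundedness. -/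
noncomputable def tailDeviation (κ : Kernel Θ Ξ) (h : Θ → Ξ → ℝ) (K : ℕ) (z : Θ × (ℕ → Ξ)) :
    ℝ≥0∞ :=
  ⨆ (M : ℕ) (_ : K ≤ M),
    ENNReal.ofReal |runningMean (fun j => h z.1 (z.2 j)) M - meanResponse κ h z.1|

section Kernel

variable {κ : Kernel Θ Ξ} {h : Θ → Ξ → ℝ}

lemma memLp_response (hh : Measurable (Function.uncurry h)) {t : Θ}
    (ht : condSecondMoment κ h t < ⊤) : MemLp (h t) 2 (κ t) := by
  have hm : Measurable (h t) := hh.comp measurable_prodMk_left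
  rw [memLp_two_iff_integrable_sq hm.aestronglyMeasurable]
  refine ⟨(hm.pow_const 2).aestronglyMeasurable, ?_⟩
  rw [hasFiniteIntegral_iff_ofReal (Eventually.of_forall fun x => sq_nonneg _)]
  exact ht

lemma tailDeviation_le (K : ℕ) (z : Θ × (ℕ → Ξ)) : tailDeviation κ h K z ≤
    (⨆ M, ENNReal.ofReal (runningMean (fun j => |h z.1 (z.2 j)|) M)) + ‖meanResponse κ h z.1‖ₑ := by
  refine iSup₂_le fun M _ => ?_
  calc ENNReal.ofReal |runningMean (fun j => h z.1 (z.2 j)) M - meanResponse κ h z.1|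
      ≤ ENNReal.ofReal (runningMean (fun j => |h z.1 (z.2 j)|) M + |meanResponse κ h z.1|) :=
        ENNReal.ofReal_le_ofReal ((abs_sub _ _).trans
          (add_le_add_left (abs_runningMean_le _ _) _))
    _ ≤ ENNReal.ofReal (runningMean (fun j => |h z.1 (z.2 j)|) M)
          + ENNReal.ofReal |meanResponse κ h z.1| := ENNReal.ofReal_add_le
    _ ≤ _ := by
        rw [Real.enorm_eq_ofReal_abs]
        gcongr
        exact le_iSup (fun M => ENNReal.ofReal (runningMean (fun j => |h z.1 (z.2 j)|) M)) M

lemma tailDeviation_anti (z : Θ × (ℕ → Ξ)) : Antitone fun K => tailDeviation κ h K z :=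
  fun _ _ hKL => iSup_mono fun _ => iSup_mono' fun hM => ⟨hKL.trans hM, le_rfl⟩

/-- Once the sample means converge, the tail suprema of their deviations vanish. -/
lemma tendsto_tailDeviation {z : Θ × (ℕ → Ξ)}
    (hz : Tendsto (runningMean fun j => h z.1 (z.2 j)) atTop (𝓝 (meanResponse κ h z.1))) :
    Tendsto (fun K => tailDeviation κ h K z) atTop (𝓝 0) := by
  rw [ENNReal.tendsto_nhds_zero]
  intro ε hε
  have h1 : Tendsto (fun M => ENNReal.ofReal
      |runningMean (fun j => h z.1 (z.2 j)) M - meanResponse κ h z.1|) atTop (𝓝 0) := by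
    simpa using ENNReal.tendsto_ofReal (hz.sub_const (meanResponse κ h z.1)).abs
  obtain ⟨K, hK⟩ := eventually_atTop.1 ((ENNReal.tendsto_nhds_zero.1 h1) ε hε)
  filter_upwards [eventually_ge_atTop K] with L hL
  exact iSup₂_le fun M hM => hK M (hL.trans hM)

variable [IsMarkovKernel κ]

lemma measurable_meanResponse (hh : Measurable (Function.uncurry h)) :
    Measurable (meanResponse κ h) :=
  (hh.stronglyMeasurable.integral_kernel_prod_right (κ := κ)).measurable

lemma measurable_response_eval (hh : Measurable (Function.uncurry h)) (j : ℕ) :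
    Measurable fun z : Θ × (ℕ → Ξ) => h z.1 (z.2 j) :=
  hh.comp (measurable_fst.prodMk ((measurable_pi_apply j).comp measurable_snd))

lemma measurable_tailDeviation (hh : Measurable (Function.uncurry h)) (K : ℕ) :
    Measurable (tailDeviation κ h K) := by
  refine Measurable.iSup fun M => Measurable.iSup fun _ => Measurable.ennreal_ofReal ?_
  have h1 : Measurable fun z : Θ × (ℕ → Ξ) => runningMean (fun j => h z.1 (z.2 j)) M :=
    (Finset.measurable_fun_sum _ fun j _ => measurable_response_eval hh j).const_mul _
  exact (h1.sub ((measurable_meanResponse hh).comp measurable_fst)).abs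

lemma enorm_meanResponse_le (t : Θ) : ‖meanResponse κ h t‖ₑ ≤ 1 + condSecondMoment κ h t :=
  (enorm_integral_le_lintegral_enorm _).trans (lintegral_enorm_le_one_add_sq _)

lemma pairwise_indepFun_seqKernel {φ : Ξ → ℝ} (hφ : Measurable φ) (t : Θ) :
    Pairwise fun i j => (fun x : ℕ → Ξ => φ (x i)) ⟂ᵢ[seqKernel κ t] fun x => φ (x j) :=
  fun _ _ hij => (iIndepFun_infinitePi (P := fun _ : ℕ => κ t) fun _ => hφ).indepFun hij

lemma measurePreserving_eval_seqKernel (t : Θ) (i : ℕ) :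
    MeasurePreserving (fun x : ℕ → Ξ => x i) (seqKernel κ t) (κ t) :=
  measurePreserving_eval_infinitePi (fun _ : ℕ => κ t) i

lemma identDistrib_seqKernel {φ : Ξ → ℝ} (hφ : Measurable φ) (t : Θ) (i : ℕ) :
    IdentDistrib (fun x : ℕ → Ξ => φ (x i)) (fun x => φ (x 0)) (seqKernel κ t) (seqKernel κ t) := by
  have h0 : IdentDistrib (fun x : ℕ → Ξ => x i) (fun x => x 0) (seqKernel κ t) (seqKernel κ t) :=
    ⟨(measurable_pi_apply i).aemeasurable, (measurable_pi_apply 0).aemeasurable, by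
      rw [(measurePreserving_eval_seqKernel t i).map_eq,
        (measurePreserving_eval_seqKernel t 0).map_eq]⟩
  exact h0.comp hφ

lemma lintegral_iSup_runningMean_response_le (hh : Measurable (Function.uncurry h)) (t : Θ) :
    ∫⁻ x, ⨆ M, ENNReal.ofReal (runningMean (fun j => |h t (x j)|) M) ∂(seqKernel κ t)
      ≤ 4 + 6 * condSecondMoment κ h t := by
  rcases eq_or_ne (condSecondMoment κ h t) ⊤ with htop | htop
  · simp [htop]
  have hm : Measurable (h t) := hh.comp measurable_prodMk_left
  have hL2 : MemLp (fun x => |h t x|) 2 (κ t) := (memLp_response hh htop.lt_top).abs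
  refine (lintegral_iSup_runningMean_le (P := seqKernel κ t) (Y := fun j x => |h t (x j)|)
    (fun j => hm.abs.comp (measurable_pi_apply j)) (fun _ _ => abs_nonneg _)
    (hL2.comp_measurePreserving (measurePreserving_eval_seqKernel t 0))
    (pairwise_indepFun_seqKernel hm.abs t) (identDistrib_seqKernel hm.abs t)).trans ?_
  simp only [sq_abs]
  rw [(measurePreserving_eval_seqKernel t 0).lintegral_comp
    (f := fun y => ENNReal.ofReal (h t y ^ 2)) (hm.pow_const 2).ennreal_ofReal]
  rfl

variable {μ : Measure Θ} [IsProbabilityMeasure μ]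

lemma lintegral_tailDeviation_lt_top (hh : Measurable (Function.uncurry h))
    (h2 : ∫⁻ t, condSecondMoment κ h t ∂μ < ⊤) (K : ℕ) :
    ∫⁻ z, tailDeviation κ h K z ∂(μ ⊗ₘ seqKernel κ) < ⊤ := by
  rw [Measure.lintegral_compProd (measurable_tailDeviation hh K)]
  have hle : ∀ t, ∫⁻ x, tailDeviation κ h K (t, x) ∂(seqKernel κ t)
      ≤ 5 + 7 * condSecondMoment κ h t := fun t => calc
    _ ≤ ∫⁻ x, ((⨆ M, ENNReal.ofReal (runningMean (fun j => |h t (x j)|) M))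
          + ‖meanResponse κ h t‖ₑ) ∂(seqKernel κ t) := lintegral_mono fun x => tailDeviation_le K (t, x)
    _ = (∫⁻ x, ⨆ M, ENNReal.ofReal (runningMean (fun j => |h t (x j)|) M) ∂(seqKernel κ t))
          + ‖meanResponse κ h t‖ₑ := by
        rw [lintegral_add_right _ measurable_const, lintegral_const, measure_univ, mul_one]
    _ ≤ (4 + 6 * condSecondMoment κ h t) + (1 + condSecondMoment κ h t) :=
        add_le_add (lintegral_iSup_runningMean_response_le hh t) (enorm_meanResponse_le t)
    _ = 5 + 7 * condSecondMoment κ h t := by ring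
  refine (lintegral_mono hle).trans_lt ?_
  rw [lintegral_add_left measurable_const, lintegral_const_mul' _ _ (by simp)]
  simpa using ENNReal.mul_lt_top (by simp) h2

/-- The strong law of large numbers for the inner samples, applied conditionally on the scenario. -/
lemma ae_tendsto_tailDeviation (hh : Measurable (Function.uncurry h))
    (h2 : ∀ᵐ t ∂μ, condSecondMoment κ h t < ⊤) :
    ∀ᵐ z ∂(μ ⊗ₘ seqKernel κ), Tendsto (fun K => tailDeviation κ h K z) atTop (𝓝 0) := by
  rw [Measure.ae_compProd_iff
    (measurableSet_tendsto _ fun K => measurable_tailDeviation hh K)]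
  filter_upwards [h2] with t ht
  have hm : Measurable (h t) := hh.comp measurable_prodMk_left
  have hmp := measurePreserving_eval_seqKernel (κ := κ) t 0
  have hint : Integrable (h t) (κ t) := (memLp_response hh ht).integrable one_le_two
  filter_upwards [strong_law_ae_real (fun j (x : ℕ → Ξ) => h t (x j))
    (hmp.integrable_comp_of_integrable hint) (pairwise_indepFun_seqKernel hm t)
    (identDistrib_seqKernel hm t)] with x hx
  have hmean : ∫ x, h t (x 0) ∂(seqKernel κ t) = meanResponse κ h t := by
    rw [meanResponse, ← hmp.map_eq,
      integral_map hmp.measurable.aemeasurable hm.aestronglyMeasurable]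
  rw [hmean] at hx
  refine tendsto_tailDeviation ?_
  simpa only [runningMean_eq_div] using hx

lemma tendsto_lintegral_tailDeviation (hh : Measurable (Function.uncurry h))
    (h2 : ∫⁻ t, condSecondMoment κ h t ∂μ < ⊤) (h2' : ∀ᵐ t ∂μ, condSecondMoment κ h t < ⊤) :
    Tendsto (fun K => ∫⁻ z, tailDeviation κ h K z ∂(μ ⊗ₘ seqKernel κ)) atTop (𝓝 0) := by
  have := tendsto_lintegral_of_dominated_convergence (μ := μ ⊗ₘ seqKernel κ)
    (tailDeviation κ h 0) (fun K => measurable_tailDeviation (κ := κ) hh K)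
    (fun K => Eventually.of_forall fun z => tailDeviation_anti z (Nat.zero_le K))
    (lintegral_tailDeviation_lt_top hh h2 0).ne (ae_tendsto_tailDeviation hh h2')
  simpa using this

lemma map_compProd_meanResponse (hh : Measurable (Function.uncurry h)) :
    (μ ⊗ₘ seqKernel κ).map (fun z => meanResponse κ h z.1) = meanResponseLaw μ κ h := by
  have hfst : (μ ⊗ₘ seqKernel κ).map Prod.fst = μ := Measure.fst_compProd μ (seqKernel κ)
  rw [meanResponseLaw]
  nth_rewrite 2 [← hfst]
  rw [Measure.map_map (measurable_meanResponse hh) measurable_fst]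
  rfl

lemma integrable_id_meanResponseLaw (hh : Measurable (Function.uncurry h))
    (h2 : ∫⁻ t, condSecondMoment κ h t ∂μ < ⊤) :
    Integrable (fun x : ℝ => x) (meanResponseLaw μ κ h) := by
  have hH : Integrable (meanResponse κ h) μ := by
    refine ⟨(measurable_meanResponse hh).aestronglyMeasurable, ?_⟩
    refine (lintegral_mono fun t => enorm_meanResponse_le t).trans_lt ?_
    rw [lintegral_add_left measurable_const]
    simpa using h2
  rw [meanResponseLaw, integrable_map_measure measurable_id'.aestronglyMeasurable
    (measurable_meanResponse hh).aemeasurable]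
  exact hH

end Kernel

/-! ### Laws of large numbers over the scenarios -/

section Sample

variable {P : Measure Ω} [IsProbabilityMeasure P] {μ : Measure Θ} [IsProbabilityMeasure μ]
  {κ : Kernel Θ Ξ} [IsMarkovKernel κ] {h : Θ → Ξ → ℝ} {θ : ℕ → Ω → Θ} {ξ : ℕ → ℕ → Ω → Ξ}

/-- The strong law of large numbers over the scenarios, each with its whole inner sample. -/
lemma IsNestedSample.ae_tendsto_runningMean (hs : IsNestedSample P μ κ θ ξ)
    {g : Θ × (ℕ → Ξ) → ℝ} (hg : Measurable g) (hint : Integrable g (μ ⊗ₘ seqKernel κ)) :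
    ∀ᵐ ω ∂P, Tendsto (runningMean fun i => g (θ i ω, fun j => ξ i j ω)) atTop
      (𝓝 (∫ z, g z ∂(μ ⊗ₘ seqKernel κ))) := by
  have hident : ∀ i, IdentDistrib (fun ω => g (θ i ω, fun j => ξ i j ω))
      (fun ω => g (θ 0 ω, fun j => ξ 0 j ω)) P P := fun i =>
    (IdentDistrib.mk (hs.measurable_pair i).aemeasurable (hs.measurable_pair 0).aemeasurable
      (by rw [hs.map_pair, hs.map_pair])).comp hg
  have hint0 : Integrable (fun ω => g (θ 0 ω, fun j => ξ 0 j ω)) P := by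
    rw [← hs.map_pair 0] at hint
    exact hint.comp_measurable (hs.measurable_pair 0)
  have hmean : P[fun ω => g (θ 0 ω, fun j => ξ 0 j ω)] = ∫ z, g z ∂(μ ⊗ₘ seqKernel κ) := by
    rw [← hs.map_pair 0, integral_map (hs.measurable_pair 0).aemeasurable
      hg.aestronglyMeasurable]
  rw [← hmean]
  filter_upwards [strong_law_ae_real (fun i ω => g (θ i ω, fun j => ξ i j ω)) hint0
    (fun i j hij => (hs.indep.indepFun hij).comp hg hg) hident] with ω hω
  simpa only [runningMean_eq_div] using hω

lemma IsNestedSample.ae_tendsto_runningMean_meanResponse (hs : IsNestedSample P μ κ θ ξ)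
    (hh : Measurable (Function.uncurry h)) {φ : ℝ → ℝ} (hφ : Measurable φ)
    (hint : Integrable φ (meanResponseLaw μ κ h)) :
    ∀ᵐ ω ∂P, Tendsto (runningMean fun i => φ (meanResponse κ h (θ i ω))) atTop
      (𝓝 (∫ x, φ x ∂(meanResponseLaw μ κ h))) := by
  have hH : Measurable fun z : Θ × (ℕ → Ξ) => meanResponse κ h z.1 :=
    (measurable_meanResponse hh).comp measurable_fst
  rw [← map_compProd_meanResponse hh] at hint ⊢
  rw [integral_map hH.aemeasurable hφ.aestronglyMeasurable]
  exact hs.ae_tendsto_runningMean (hφ.comp hH) (hint.comp_measurable hH)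

/-- Almost surely, the average over the scenarios of the errors of the inner sample means vanishes
in the double limit. The maximal inequality makes this uniform in the inner sample size. -/
lemma IsNestedSample.ae_tendsto_runningMean_deviation (hs : IsNestedSample P μ κ θ ξ)
    (hh : Measurable (Function.uncurry h))
    (h2 : ∫⁻ t, condSecondMoment κ h t ∂μ < ⊤) (h2' : ∀ᵐ t ∂μ, condSecondMoment κ h t < ⊤) :
    ∀ᵐ ω ∂P, Tendsto (fun q : ℕ × ℕ => runningMean
      (fun i => |sampleMean h θ ξ q.2 i ω - meanResponse κ h (θ i ω)|) q.1)
      (atTop ×ˢ atTop) (𝓝 0) := by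
  have hfin : ∀ᵐ ω ∂P, ∀ i, tailDeviation κ h 0 (θ i ω, fun j => ξ i j ω) < ⊤ := by
    refine ae_all_iff.2 fun i => ?_
    refine ae_of_ae_map (hs.measurable_pair i).aemeasurable
      (p := fun z => tailDeviation κ h 0 z < ⊤) ?_
    rw [hs.map_pair i]
    exact ae_lt_top (measurable_tailDeviation hh 0) (lintegral_tailDeviation_lt_top hh h2 0).ne
  have hslln : ∀ᵐ ω ∂P, ∀ K, Tendsto
      (runningMean fun i => (tailDeviation κ h K (θ i ω, fun j => ξ i j ω)).toReal) atTop
      (𝓝 (∫⁻ z, tailDeviation κ h K z ∂(μ ⊗ₘ seqKernel κ)).toReal) := by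
    refine ae_all_iff.2 fun K => ?_
    have hm := measurable_tailDeviation (κ := κ) hh K
    have hlt := lintegral_tailDeviation_lt_top (κ := κ) hh h2 K
    rw [← integral_toReal hm.aemeasurable (ae_lt_top hm hlt.ne)]
    exact hs.ae_tendsto_runningMean hm.ennreal_toReal
      (integrable_toReal_of_lintegral_ne_top hm.aemeasurable hlt.ne)
  have hρ : Tendsto (fun K => (∫⁻ z, tailDeviation κ h K z ∂(μ ⊗ₘ seqKernel κ)).toReal) atTop
      (𝓝 0) := by
    exact (ENNReal.tendsto_toReal ENNReal.zero_ne_top).comp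
      (tendsto_lintegral_tailDeviation hh h2 h2')
  filter_upwards [hfin, hslln] with ω hω1 hω2
  refine tendsto_runningMean_deviation
    (d := fun M i => |sampleMean h θ ξ M i ω - meanResponse κ h (θ i ω)|)
    (fun _ _ => abs_nonneg _) (fun K M i hKM => ?_) hω2 hρ
  have hne : tailDeviation κ h K (θ i ω, fun j => ξ i j ω) ≠ ⊤ :=
    ((tailDeviation_anti _ (Nat.zero_le K)).trans_lt (hω1 i)).ne
  rw [← ENNReal.ofReal_le_iff_le_toReal hne]
  exact le_iSup₂ (f := fun (M : ℕ) (_ : K ≤ M) => ENNReal.ofReal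
    |runningMean (fun j => h (θ i ω) (ξ i j ω)) M - meanResponse κ h (θ i ω)|) M hKM

end Sample

end NestedSampling

end NestedRisk

theorem theorem3p2 {Θ Ξ Ω : Type*} [MeasurableSpace Θ] [MeasurableSpace Ξ] [MeasurableSpace Ω]
    (P : Measure Ω) [IsProbabilityMeasure P]
    (μ : Measure Θ) [IsProbabilityMeasure μ]
    (κ : Kernel Θ Ξ) [IsMarkovKernel κ]
    (h : Θ → Ξ → ℝ) (hh : Measurable (Function.uncurry h))
    (θ : ℕ → Ω → Θ) (ξ : ℕ → ℕ → Ω → Ξ)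
    (hsample : NestedRisk.IsNestedSample P μ κ θ ξ)
    (α : ℝ) (hα0 : 0 < α) (hα1 : α < 1)
    (hstrong : NestedRisk.StrongAssumption P μ κ h θ ξ)
    (f : ℝ → ℝ) (hf : NestedRisk.IsDensity (NestedRisk.meanResponseLaw μ κ h) f)
    (hfcont : ContinuousAt f (NestedRisk.valueAtRisk (NestedRisk.meanResponseLaw μ κ h) α))
    (hfpos : 0 < f (NestedRisk.valueAtRisk (NestedRisk.meanResponseLaw μ κ h) α)) :
    (∀ᵐ ω ∂P, Tendsto (fun q : ℕ × ℕ => NestedRisk.nestedVaR α h θ ξ q.1 q.2 ω)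
      (atTop ×ˢ atTop)
      (𝓝 (NestedRisk.valueAtRisk (NestedRisk.meanResponseLaw μ κ h) α))) ∧
    (∀ᵐ ω ∂P, Tendsto (fun q : ℕ × ℕ => NestedRisk.nestedCVaR α h θ ξ q.1 q.2 ω)
      (atTop ×ˢ atTop)
      (𝓝 (NestedRisk.condValueAtRisk (NestedRisk.meanResponseLaw μ κ h) α))) := by
  have hmH : Measurable (NestedRisk.meanResponse κ h) := NestedRisk.measurable_meanResponse hh
  set ν := NestedRisk.meanResponseLaw μ κ h with hν
  have : IsProbabilityMeasure ν := Measure.isProbabilityMeasure_map hmH.aemeasurable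
  set v := NestedRisk.valueAtRisk ν α with hv
  have hdev := hsample.ae_tendsto_runningMean_deviation hh hstrong.secondMoment_lt_top
    hstrong.condSecondMoment_lt_top
  have hcdf : ∀ᵐ ω ∂P, ∀ q : ℚ, Tendsto (NestedRisk.runningMean fun i =>
      (Set.Iic (q : ℝ)).indicator 1 (NestedRisk.meanResponse κ h (θ i ω))) atTop
      (𝓝 (cdf ν q)) := by
    refine ae_all_iff.2 fun q => ?_
    rw [cdf_eq_real, ← integral_indicator_one measurableSet_Iic]
    exact hsample.ae_tendsto_runningMean_meanResponse hh (measurable_one.indicator measurableSet_Iic)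
      ((integrable_const (1 : ℝ)).indicator measurableSet_Iic)
  have hexc := hsample.ae_tendsto_runningMean_meanResponse (φ := fun x => max (x - v) 0) hh
    ((measurable_id.sub_const v).max measurable_const)
    (((NestedRisk.integrable_id_meanResponseLaw hh hstrong.secondMoment_lt_top).sub
      (integrable_const v)).pos_part)
  have hVaR : ∀ᵐ ω ∂P, Tendsto (fun q : ℕ × ℕ => NestedRisk.nestedVaR α h θ ξ q.1 q.2 ω)
      (atTop ×ˢ atTop) (𝓝 v) := by
    filter_upwards [hdev, hcdf] with ω hω1 hω2
    exact NestedRisk.tendsto_orderStat hα0 hα1.le (F := cdf ν)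
      (fun t ht => NestedRisk.cdf_lt_of_lt_valueAtRisk hα0 ht)
      (fun t ht => NestedRisk.lt_cdf_of_valueAtRisk_lt hα1 hf hfcont hfpos ht)
      (a := fun i => NestedRisk.meanResponse κ h (θ i ω))
      (b := fun M i => NestedRisk.sampleMean h θ ξ M i ω) hω2 hω1
  refine ⟨hVaR, ?_⟩
  filter_upwards [hdev, hVaR, hexc] with ω hω1 hω2 hω3
  have hlim := NestedRisk.tendsto_runningMean_excess hω2
    (a := fun i => NestedRisk.meanResponse κ h (θ i ω))
    (b := fun M i => NestedRisk.sampleMean h θ ξ M i ω) hω3 hω1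
  refine (hω2.add (hlim.const_mul (1 / (1 - α)))).congr fun q => ?_
  rw [NestedRisk.nestedCVaR, NestedRisk.runningMean, ← mul_assoc, one_div_mul_one_div]
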